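/- Notation and conventions. Bodies are points $x_i=(x_{i1},x_{i2})\in\mathbb R^2$ with masses $m_i\in\mathbb R$ ($1\le i\le 6$) with $M=\sum_i m_i\neq 0$; $r_{ij}=\|x_i-x_j\|$ and $c=\frac1M\sum_i m_ix_i$. A configuration $x=(x_1,\dots,x_6)$ with pairwise distinct $x_i$ is \emph{central} if there is $\lambda\ne0$ with $$\sum_{j\ne i} m_j\, r_{ij}^{-3}(x_j-x_i)+\lambda(x_i-c)=0,\qquad i=1,\dots,6 .$$ It is a \emph{cross central configuration} if moreover $x_1,\dots,x_6$ affinely span $\mathbb R^2$ and there is a line $s$ such that the set $\{x_1,\dots,x_6\}$ is invariant under reflection in $s$, $x_1,x_2,x_3,x_4\in s$ and $x_5,x_6\notin s$. It is \emph{normalized} if in addition $c=0$, $x_{52}=x_{62}$, and (i) $x_{12}>x_{22}>x_{32}>x_{42}$, (ii) $x_{52}>x_{32}$, (iii) $x_{52}-x_{42}=1$, (iv) $x_{51}<x_{11}<x_{61}$. (After a translation, a rotation, a dilation and a re-indexing one may assume this.) Proposition. Let $m_1=m_2=m_3=m_4=1$ and $m_5=m_6$, where $m_5\in\mathbb R$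 is not prescribed. There is exactly one pair $(m_5,x)$ such that $x$ is a normalized cross central configuration for these masses satisfying 1. $x_1,x_2,x_3,x_4$ are collinear; 2. $x_2,x_3,x_5,x_6$ are the vertices of a square centred at the origin, with $x_2,x_3$ on the $y$-axis and $x_5,x_6$ on the $x$-axis; 3. $r_{12}=r_{34}$ and $r_{14}=2$. For this pair, $r_{12}$ is the unique root in the interval $(0,1]$ of the polynomial of degree $52$ $$\begin{aligned}h(X)= &49X^{52}-2548X^{51}+66738X^{50}-1172696X^{49}\\ &{}+15533875X^{48}-165243456X^{47}+1468322114X^{46}-11192036548X^{45}\\ &{}+74573116361X^{44}-440423422856X^{43}+2329838631760X^{42}-11128934949872X^{41}\\ &{}+48305154457928X^{40}-191475448922080X^{39}+695897967472096X^{38}-2326434642996096X^{37}\\ &{}+7172835194517872X^{36}-20440040451991808X^{35}+53929262731328768X^{34}-131921068408604672X^{33}\\ &{}+299482798734859264X^{32}-631284391053388800X^{31}+1235615625320621568X^{30}-2244481106995450880X^{29}\\ &{}+3779453556222568192X^{28}-5888938217094555648X^{27}+8468544105051484160X^{26}-11198444817980125184X^{25}\\ &{}+13546242030295132160X^{24}-14872802421811535872X^{23}+14633949894350086144X^{22}-12609227523208839168X^{21}\\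 &{}+9048779192012738560X^{20}-4647057850941046784X^{19}+330497465653198848X^{18}+3055523827167395840X^{17}\\ &{}-5018257768792850432X^{16}+5528131524414668800X^{15}-4937103223795744768X^{14}+3771552248163729408X^{13}\\ &{}-2515098724390141952X^{12}+1475194522563510272X^{11}-761820619200266240X^{10}+345302319300083712X^{9}\\ &{}-136475713791328256X^{8}+46571837924048896X^{7}-13532682814226432X^{6}+3284851654393856X^{5}\\ &{}-648321286799360X^{4}+99976101232640X^{3}-11302206439424X^{2}+833223655424X\\ &{}-30064771072 \end{aligned}$$ and $$0.4402418528<r_{12}\le 0.4402418529,\qquad 4.76482836\le m_5<4.76482837 .$$ (In particular $m_5>0$.) -/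

import Mathlib

open Polynomial
open scoped BigOperators

noncomputable section

namespace CrossCC

/-- The Euclidean plane `ℝ²`; coordinates are `p 0` (abscissa) and `p 1` (ordinate). -/
abbrev Plane : Type := EuclideanSpace ℝ (Fin 2)

/-- `x = (x₁, …, xₙ)` is a central configuration of the Newtonian `n`-body problem in `ℝ^d` with
masses `m`: it has no collisions, the total mass is nonzero, and there is `l ≠ 0` with
`∑_{j ≠ i} m_j (x_j - x_i) r_ij⁻³ + l (x_i - c) = 0` for all `i`, where `c` is the centre of mass
`(∑ m_j)⁻¹ ∑ m_j x_j`. -/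
def IsCentralConfiguration {n d : ℕ} (m : Fin n → ℝ) (x : Fin n → EuclideanSpace ℝ (Fin d)) :
    Prop :=
  Function.Injective x ∧ ∑ i, m i ≠ 0 ∧
    ∃ l : ℝ, l ≠ 0 ∧ ∀ i,
      ∑ j ∈ Finset.univ.erase i, (m j * (dist (x i) (x j) ^ 3)⁻¹) • (x j - x i) +
        l • (x i - Finset.univ.centerMass m x) = 0

/-- `s` is a line and the set `X` is invariant under the orthogonal reflection in `s`. -/
def IsSymmetryLine (s : AffineSubspace ℝ Plane) (X : Set Plane) : Prop :=
  Module.finrank ℝ s.direction = 1 ∧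
    ∃ _ : Nonempty s, EuclideanGeometry.reflection s '' X = X

/-- Cross central configurations of the six-body problem: central configurations of dimension two
having a symmetry line with precisely four bodies on it. The bodies are indexed so that the four
bodies on the line are `x₁, x₂, x₃, x₄`; the index set `Fin 6` is `0, …, 5`, so that `x i` is the
body usually written with index `i + 1`. -/
def IsCrossCentralConfiguration (m : Fin 6 → ℝ) (x : Fin 6 → Plane) : Prop :=
  IsCentralConfiguration m x ∧ affineSpan ℝ (Set.range x) = ⊤ ∧
    ∃ s : AffineSubspace ℝ Plane, IsSymmetryLine s (Set.range x) ∧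
      ∀ i : Fin 6, x i ∈ s ↔ i.val < 4

/-- Normalized cross central configurations (representatives modulo translations, rotations,
dilations and re-indexing): the centre of mass is the origin, the line through the two bodies
`x₅, x₆` is parallel to the first coordinate axis, and
(i) `x₁₂ > x₂₂ > x₃₂ > x₄₂`, (ii) `x₅₂ > x₃₂`, (iii) `x₅₂ - x₄₂ = 1`,
(iv) `x₅₁ < x₁₁ < x₆₁`, where `(x_{i1}, x_{i2})` are the coordinates of `x_i`. -/
structure IsNormalizedCross (m : Fin 6 → ℝ) (x : Fin 6 → Plane) : Prop where
  cross : IsCrossCentralConfiguration m x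
  center : Finset.univ.centerMass m x = 0
  horizontal : x 4 1 = x 5 1
  order₁₂ : x 1 1 < x 0 1
  order₂₃ : x 2 1 < x 1 1
  order₃₄ : x 3 1 < x 2 1
  above : x 2 1 < x 4 1
  scale : x 4 1 - x 3 1 = 1
  left : x 4 0 < x 0 0
  right : x 0 0 < x 5 0

/-- `S` is the set of vertices of a (nondegenerate) square with centre `c`: the four vertices are
the endpoints of two orthogonal diagonals of equal length with common midpoint `c`. -/
def IsSquareVertexSet (c : Plane) (S : Set Plane) : Prop :=
  ∃ u v : Plane, u ≠ 0 ∧ ‖u‖ = ‖v‖ ∧ inner ℝ u v = 0 ∧ S = {c + u, c - u, c + v, c - v}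

/-- A normalized cross central configuration such that `x₁, x₂, x₃, x₄` are collinear, the points
`x₂, x₃, x₅, x₆` are the vertices of a square centred at the origin with `x₂, x₃` on the `y`-axis
and `x₅, x₆` on the `x`-axis, `r₁₂ = r₃₄` and `r₁₄ = 2`. -/
structure IsSquareCross (m : Fin 6 → ℝ) (x : Fin 6 → Plane) : Prop where
  normalized : IsNormalizedCross m x
  collinear : Collinear ℝ {x 0, x 1, x 2, x 3}
  square : IsSquareVertexSet 0 {x 1, x 2, x 4, x 5}
  yAxis : x 1 0 = 0 ∧ x 2 0 = 0
  xAxis : x 4 1 = 0 ∧ x 5 1 = 0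
  dist₁₂ : dist (x 0) (x 1) = dist (x 2) (x 3)
  dist₁₄ : dist (x 0) (x 3) = 2

/-- The polynomial of degree 52 whose root is the mutual distance `r₁₂`. -/
def h : ℤ[X] :=
    49 * X ^ 52
    - 2548 * X ^ 51
    + 66738 * X ^ 50
    - 1172696 * X ^ 49
    + 15533875 * X ^ 48
    - 165243456 * X ^ 47
    + 1468322114 * X ^ 46
    - 11192036548 * X ^ 45
    + 74573116361 * X ^ 44
    - 440423422856 * X ^ 43
    + 2329838631760 * X ^ 42
    - 11128934949872 * X ^ 41
    + 48305154457928 * X ^ 40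
    - 191475448922080 * X ^ 39
    + 695897967472096 * X ^ 38
    - 2326434642996096 * X ^ 37
    + 7172835194517872 * X ^ 36
    - 20440040451991808 * X ^ 35
    + 53929262731328768 * X ^ 34
    - 131921068408604672 * X ^ 33
    + 299482798734859264 * X ^ 32
    - 631284391053388800 * X ^ 31
    + 1235615625320621568 * X ^ 30
    - 2244481106995450880 * X ^ 29
    + 3779453556222568192 * X ^ 28
    - 5888938217094555648 * X ^ 27
    + 8468544105051484160 * X ^ 26
    - 11198444817980125184 * X ^ 25
    + 13546242030295132160 * X ^ 24
    - 14872802421811535872 * X ^ 23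
    + 14633949894350086144 * X ^ 22
    - 12609227523208839168 * X ^ 21
    + 9048779192012738560 * X ^ 20
    - 4647057850941046784 * X ^ 19
    + 330497465653198848 * X ^ 18
    + 3055523827167395840 * X ^ 17
    - 5018257768792850432 * X ^ 16
    + 5528131524414668800 * X ^ 15
    - 4937103223795744768 * X ^ 14
    + 3771552248163729408 * X ^ 13
    - 2515098724390141952 * X ^ 12
    + 1475194522563510272 * X ^ 11
    - 761820619200266240 * X ^ 10
    + 345302319300083712 * X ^ 9
    - 136475713791328256 * X ^ 8
    + 46571837924048896 * X ^ 7
    - 13532682814226432 * X ^ 6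
    + 3284851654393856 * X ^ 5
    - 648321286799360 * X ^ 4
    + 99976101232640 * X ^ 3
    - 11302206439424 * X ^ 2
    + 833223655424 * X
    - 30064771072

end CrossCC

end

namespace CrossCC

/-! The normalization and the square condition leave one free parameter: every admissible
configuration is `squareCross r` with `r = r₁₂` in `(0, 1)` (`IsSquareCross.exists_eq_squareCross`).
By the two reflection symmetries, the equations of motion reduce to one scalar equation for each of
`x₁, x₂, x₅` (`central_equations_iff`). These are linear in the multiplier and the mass. Eliminating
the multiplier leaves two equations for `m₅`; the first has positive coefficient `massDen r`, so it
determines `m₅`, and the two are compatible exactly when `distEq r = 0`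
(`exists_bodyEquations_iff`).

The function `distEq` has the form `A + B√2 + C√(1 + (1 - r)²)` with polynomials `A, B, C` in `r`,
and `h` is its norm. So a zero of `distEq` is a root of `h` (`aeval_h_of_distEq`); the converse is
not clear, since a conjugate factor might vanish instead. It is not needed: `h` has at most one root
in `(0, 1]` by Descartes' rule of signs (`h_root_unique`), and the intermediate value theorem gives
a zero of `distEq` in a tiny interval (`exists_distEq_eq_zero`). That zero is therefore the only
root of `h`, and the only admissible `r`. The same interval is narrow enough to enclose the mass
(`mass_mem_Ico`). -/

set_option maxRecDepth 10000 in
theorem aeval_h (r : ℝ) : aeval r h =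
    -30064771072 + 833223655424 * r - 11302206439424 * r ^ 2 + 99976101232640 * r ^ 3
    - 648321286799360 * r ^ 4 + 3284851654393856 * r ^ 5 - 13532682814226432 * r ^ 6
    + 46571837924048896 * r ^ 7 - 136475713791328256 * r ^ 8 + 345302319300083712 * r ^ 9
    - 761820619200266240 * r ^ 10 + 1475194522563510272 * r ^ 11 - 2515098724390141952 * r ^ 12
    + 3771552248163729408 * r ^ 13 - 4937103223795744768 * r ^ 14 + 5528131524414668800 * r ^ 15
    - 5018257768792850432 * r ^ 16 + 3055523827167395840 * r ^ 17 + 330497465653198848 * r ^ 18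
    - 4647057850941046784 * r ^ 19 + 9048779192012738560 * r ^ 20
    - 12609227523208839168 * r ^ 21 + 14633949894350086144 * r ^ 22
    - 14872802421811535872 * r ^ 23 + 13546242030295132160 * r ^ 24
    - 11198444817980125184 * r ^ 25 + 8468544105051484160 * r ^ 26
    - 5888938217094555648 * r ^ 27 + 3779453556222568192 * r ^ 28 - 2244481106995450880 * r ^ 29
    + 1235615625320621568 * r ^ 30 - 631284391053388800 * r ^ 31 + 299482798734859264 * r ^ 32
    - 131921068408604672 * r ^ 33 + 53929262731328768 * r ^ 34 - 20440040451991808 * r ^ 35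
    + 7172835194517872 * r ^ 36 - 2326434642996096 * r ^ 37 + 695897967472096 * r ^ 38
    - 191475448922080 * r ^ 39 + 48305154457928 * r ^ 40 - 11128934949872 * r ^ 41
    + 2329838631760 * r ^ 42 - 440423422856 * r ^ 43 + 74573116361 * r ^ 44
    - 11192036548 * r ^ 45 + 1468322114 * r ^ 46 - 165243456 * r ^ 47 + 15533875 * r ^ 48
    - 1172696 * r ^ 49 + 66738 * r ^ 50 - 2548 * r ^ 51 + 49 * r ^ 52 := by
  unfold h
  rw [aeval_def, eval₂_eq_eval_map]
  simp only [Polynomial.map_add, Polynomial.map_sub, Polynomial.map_mul, Polynomial.map_pow,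
    Polynomial.map_X, Polynomial.map_ofNat, eval_add, eval_sub, eval_mul, eval_pow, eval_X,
    eval_ofNat]
  ring

set_option maxRecDepth 10000 in
theorem natDegree_h : h.natDegree = 52 := by
  unfold h
  compute_degree!

/-! ### Uniqueness of the root of `h` in the unit interval -/

set_option maxRecDepth 10000 in
/-- The part of positive coefficients of `(1 + u) ^ 52 * h (u / (1 + u))`, divided by `u ^ 18`. -/
noncomputable def highPart (u : ℝ) : ℝ :=
  419225052277047296 + 1953357674222714880 * u + 3857175858506272768 * u ^ 2
  + 5870811968244350976 * u ^ 3 + 7659059202975473664 * u ^ 4 + 8903036166034382848 * u ^ 5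
  + 9393909590086264832 * u ^ 6 + 9090338190706978816 * u ^ 7 + 8118163116104585216 * u ^ 8
  + 6717438379435370496 * u ^ 9 + 5163142530124740352 * u ^ 10 + 3691904367629227008 * u ^ 11
  + 2457809656780310016 * u ^ 12 + 1523638570228931584 * u ^ 13 + 879232322702070784 * u ^ 14
  + 471916276238074880 * u ^ 15 + 235302708819787520 * u ^ 16 + 108807811366495488 * u ^ 17
  + 46562460605726832 * u ^ 18 + 18391205950946176 * u ^ 19 + 6683396613932512 * u ^ 20
  + 2226044940588000 * u ^ 21 + 676442617981256 * u ^ 22 + 186511924073776 * u ^ 23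
  + 46354965605424 * u ^ 24 + 10302115651464 * u ^ 25 + 2027375160377 * u ^ 26
  + 348979430212 * u ^ 27 + 51729152706 * u ^ 28 + 6468661696 * u ^ 29 + 663451523 * u ^ 30
  + 53576600 * u ^ 31 + 3193330 * u ^ 32 + 124852 * u ^ 33 + 2401 * u ^ 34

set_option maxRecDepth 10000 in
/-- The part of negative coefficients of `(1 + u) ^ 52 * h (u / (1 + u))`, negated. -/
noncomputable def lowPart (u : ℝ) : ℝ :=
  30064771072 + 730144440320 * u + 8673686454272 * u ^ 2 + 67205500764160 * u ^ 3
  + 382097738956800 * u ^ 4 + 1700467209928704 * u ^ 5 + 6171403611013120 * u ^ 6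
  + 18792476395438080 * u ^ 7 + 49035347027296256 * u ^ 8 + 111430339481567232 * u ^ 9
  + 223342569294135296 * u ^ 10 + 398613872048603136 * u ^ 11 + 637283190805889024 * u ^ 12
  + 913467958781542400 * u ^ 13 + 1164944076318441472 * u ^ 14 + 1289209287535493120 * u ^ 15
  + 1152146370117107712 * u ^ 16 + 615104473155108864 * u ^ 17

-- The substitution `r = u / (1 + u)` carries `(0, ∞)` onto `(0, 1)`. After it the coefficients
-- change sign only once, between degrees 17 and 18, which makes Descartes' rule applicable.
set_option maxRecDepth 100000 in
set_option maxHeartbeats 4000000 in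
theorem homogenized_h (u : ℝ) :
    -30064771072 * (u ^ 0 * (1 + u) ^ 52) + 833223655424 * (u ^ 1 * (1 + u) ^ 51)
    - 11302206439424 * (u ^ 2 * (1 + u) ^ 50) + 99976101232640 * (u ^ 3 * (1 + u) ^ 49)
    - 648321286799360 * (u ^ 4 * (1 + u) ^ 48) + 3284851654393856 * (u ^ 5 * (1 + u) ^ 47)
    - 13532682814226432 * (u ^ 6 * (1 + u) ^ 46) + 46571837924048896 * (u ^ 7 * (1 + u) ^ 45)
    - 136475713791328256 * (u ^ 8 * (1 + u) ^ 44) + 345302319300083712 * (u ^ 9 * (1 + u) ^ 43)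
    - 761820619200266240 * (u ^ 10 * (1 + u) ^ 42)
    + 1475194522563510272 * (u ^ 11 * (1 + u) ^ 41)
    - 2515098724390141952 * (u ^ 12 * (1 + u) ^ 40)
    + 3771552248163729408 * (u ^ 13 * (1 + u) ^ 39)
    - 4937103223795744768 * (u ^ 14 * (1 + u) ^ 38)
    + 5528131524414668800 * (u ^ 15 * (1 + u) ^ 37)
    - 5018257768792850432 * (u ^ 16 * (1 + u) ^ 36)
    + 3055523827167395840 * (u ^ 17 * (1 + u) ^ 35)
    + 330497465653198848 * (u ^ 18 * (1 + u) ^ 34)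
    - 4647057850941046784 * (u ^ 19 * (1 + u) ^ 33)
    + 9048779192012738560 * (u ^ 20 * (1 + u) ^ 32)
    - 12609227523208839168 * (u ^ 21 * (1 + u) ^ 31)
    + 14633949894350086144 * (u ^ 22 * (1 + u) ^ 30)
    - 14872802421811535872 * (u ^ 23 * (1 + u) ^ 29)
    + 13546242030295132160 * (u ^ 24 * (1 + u) ^ 28)
    - 11198444817980125184 * (u ^ 25 * (1 + u) ^ 27)
    + 8468544105051484160 * (u ^ 26 * (1 + u) ^ 26)
    - 5888938217094555648 * (u ^ 27 * (1 + u) ^ 25)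
    + 3779453556222568192 * (u ^ 28 * (1 + u) ^ 24)
    - 2244481106995450880 * (u ^ 29 * (1 + u) ^ 23)
    + 1235615625320621568 * (u ^ 30 * (1 + u) ^ 22)
    - 631284391053388800 * (u ^ 31 * (1 + u) ^ 21)
    + 299482798734859264 * (u ^ 32 * (1 + u) ^ 20)
    - 131921068408604672 * (u ^ 33 * (1 + u) ^ 19) + 53929262731328768 * (u ^ 34 * (1 + u) ^ 18)
    - 20440040451991808 * (u ^ 35 * (1 + u) ^ 17) + 7172835194517872 * (u ^ 36 * (1 + u) ^ 16)
    - 2326434642996096 * (u ^ 37 * (1 + u) ^ 15) + 695897967472096 * (u ^ 38 * (1 + u) ^ 14)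
    - 191475448922080 * (u ^ 39 * (1 + u) ^ 13) + 48305154457928 * (u ^ 40 * (1 + u) ^ 12)
    - 11128934949872 * (u ^ 41 * (1 + u) ^ 11) + 2329838631760 * (u ^ 42 * (1 + u) ^ 10)
    - 440423422856 * (u ^ 43 * (1 + u) ^ 9) + 74573116361 * (u ^ 44 * (1 + u) ^ 8)
    - 11192036548 * (u ^ 45 * (1 + u) ^ 7) + 1468322114 * (u ^ 46 * (1 + u) ^ 6)
    - 165243456 * (u ^ 47 * (1 + u) ^ 5) + 15533875 * (u ^ 48 * (1 + u) ^ 4)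
    - 1172696 * (u ^ 49 * (1 + u) ^ 3) + 66738 * (u ^ 50 * (1 + u) ^ 2)
    - 2548 * (u ^ 51 * (1 + u) ^ 1) + 49 * (u ^ 52 * (1 + u) ^ 0) =
      u ^ 18 * highPart u - lowPart u := by
  unfold highPart lowPart
  ring

theorem pow_mul_aeval_h (x v : ℝ) : v ^ 52 * aeval x h =
    -30064771072 * ((x * v) ^ 0 * v ^ 52) + 833223655424 * ((x * v) ^ 1 * v ^ 51)
    - 11302206439424 * ((x * v) ^ 2 * v ^ 50) + 99976101232640 * ((x * v) ^ 3 * v ^ 49)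
    - 648321286799360 * ((x * v) ^ 4 * v ^ 48) + 3284851654393856 * ((x * v) ^ 5 * v ^ 47)
    - 13532682814226432 * ((x * v) ^ 6 * v ^ 46) + 46571837924048896 * ((x * v) ^ 7 * v ^ 45)
    - 136475713791328256 * ((x * v) ^ 8 * v ^ 44) + 345302319300083712 * ((x * v) ^ 9 * v ^ 43)
    - 761820619200266240 * ((x * v) ^ 10 * v ^ 42)
    + 1475194522563510272 * ((x * v) ^ 11 * v ^ 41)
    - 2515098724390141952 * ((x * v) ^ 12 * v ^ 40)
    + 3771552248163729408 * ((x * v) ^ 13 * v ^ 39)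
    - 4937103223795744768 * ((x * v) ^ 14 * v ^ 38)
    + 5528131524414668800 * ((x * v) ^ 15 * v ^ 37)
    - 5018257768792850432 * ((x * v) ^ 16 * v ^ 36)
    + 3055523827167395840 * ((x * v) ^ 17 * v ^ 35)
    + 330497465653198848 * ((x * v) ^ 18 * v ^ 34)
    - 4647057850941046784 * ((x * v) ^ 19 * v ^ 33)
    + 9048779192012738560 * ((x * v) ^ 20 * v ^ 32)
    - 12609227523208839168 * ((x * v) ^ 21 * v ^ 31)
    + 14633949894350086144 * ((x * v) ^ 22 * v ^ 30)
    - 14872802421811535872 * ((x * v) ^ 23 * v ^ 29)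
    + 13546242030295132160 * ((x * v) ^ 24 * v ^ 28)
    - 11198444817980125184 * ((x * v) ^ 25 * v ^ 27)
    + 8468544105051484160 * ((x * v) ^ 26 * v ^ 26)
    - 5888938217094555648 * ((x * v) ^ 27 * v ^ 25)
    + 3779453556222568192 * ((x * v) ^ 28 * v ^ 24)
    - 2244481106995450880 * ((x * v) ^ 29 * v ^ 23)
    + 1235615625320621568 * ((x * v) ^ 30 * v ^ 22)
    - 631284391053388800 * ((x * v) ^ 31 * v ^ 21)
    + 299482798734859264 * ((x * v) ^ 32 * v ^ 20)
    - 131921068408604672 * ((x * v) ^ 33 * v ^ 19) + 53929262731328768 * ((x * v) ^ 34 * v ^ 18)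
    - 20440040451991808 * ((x * v) ^ 35 * v ^ 17) + 7172835194517872 * ((x * v) ^ 36 * v ^ 16)
    - 2326434642996096 * ((x * v) ^ 37 * v ^ 15) + 695897967472096 * ((x * v) ^ 38 * v ^ 14)
    - 191475448922080 * ((x * v) ^ 39 * v ^ 13) + 48305154457928 * ((x * v) ^ 40 * v ^ 12)
    - 11128934949872 * ((x * v) ^ 41 * v ^ 11) + 2329838631760 * ((x * v) ^ 42 * v ^ 10)
    - 440423422856 * ((x * v) ^ 43 * v ^ 9) + 74573116361 * ((x * v) ^ 44 * v ^ 8)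
    - 11192036548 * ((x * v) ^ 45 * v ^ 7) + 1468322114 * ((x * v) ^ 46 * v ^ 6)
    - 165243456 * ((x * v) ^ 47 * v ^ 5) + 15533875 * ((x * v) ^ 48 * v ^ 4)
    - 1172696 * ((x * v) ^ 49 * v ^ 3) + 66738 * ((x * v) ^ 50 * v ^ 2)
    - 2548 * ((x * v) ^ 51 * v ^ 1) + 49 * ((x * v) ^ 52 * v ^ 0) := by
  rw [aeval_h]
  ring

theorem aeval_h_div_one_add {u : ℝ} (hu : 0 < u) :
    (1 + u) ^ 52 * aeval (u / (1 + u)) h = u ^ 18 * highPart u - lowPart u := by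
  have hu' : 1 + u ≠ 0 := by positivity
  rw [← homogenized_h, pow_mul_aeval_h, div_mul_cancel₀ _ hu']

theorem highPart_mono {u v : ℝ} (hu : 0 < u) (huv : u ≤ v) : highPart u ≤ highPart v := by
  unfold highPart
  gcongr

theorem highPart_pos {u : ℝ} (hu : 0 < u) : 0 < highPart u := by
  unfold highPart
  positivity

/-- All coefficients of `lowPart` are positive and its degree is 17, so `lowPart u / u ^ 17` is a
combination of nonpositive powers of `u` and hence decreasing. -/
theorem lowPart_mul_le {u v : ℝ} (hu : 0 < u) (huv : u ≤ v) :
    u ^ 17 * lowPart v ≤ v ^ 17 * lowPart u := by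
  have key : ∀ k j : ℕ, k + j = 17 → u ^ 17 * v ^ k ≤ v ^ 17 * u ^ k := by
    intro k j hk
    have hv := hu.trans_le huv
    have h1 : u ^ j ≤ v ^ j := by gcongr
    have h2 : 0 ≤ u ^ k * v ^ k := by positivity
    calc u ^ 17 * v ^ k = u ^ k * v ^ k * u ^ j := by rw [← hk]; ring
      _ ≤ u ^ k * v ^ k * v ^ j := by gcongr
      _ = v ^ 17 * u ^ k := by rw [← hk]; ring
  have k1 := key 1 16 rfl
  rw [pow_one, pow_one] at k1
  unfold lowPart
  linarith [key 0 17 rfl, k1, key 2 15 rfl, key 3 14 rfl, key 4 13 rfl, key 5 12 rfl,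
    key 6 11 rfl, key 7 10 rfl, key 8 9 rfl, key 9 8 rfl, key 10 7 rfl, key 11 6 rfl,
    key 12 5 rfl, key 13 4 rfl, key 14 3 rfl, key 15 2 rfl, key 16 1 rfl]

/-- Descartes' rule for one sign change: after division by `u ^ 17` the first term, `u * highPart
u`, is strictly increasing and the subtracted one is decreasing. -/
theorem homogenized_root_unique {u v : ℝ} (hu : 0 < u) (huv : u < v)
    (h1 : u ^ 18 * highPart u - lowPart u = 0) : 0 < v ^ 18 * highPart v - lowPart v := by
  have hv := hu.trans huv
  have a := highPart_mono hu huv.le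
  have b := highPart_pos hu
  have c := lowPart_mul_le hu huv.le
  have d : v ^ 17 * (u ^ 18 * highPart u) < u ^ 17 * (v ^ 18 * highPart v) := by
    calc v ^ 17 * (u ^ 18 * highPart u) = u ^ 17 * (v ^ 17 * u * highPart u) := by ring
      _ < u ^ 17 * (v ^ 17 * v * highPart u) := by gcongr
      _ ≤ u ^ 17 * (v ^ 17 * v * highPart v) := by gcongr
      _ = u ^ 17 * (v ^ 18 * highPart v) := by ring
  have e : 0 < u ^ 17 * (v ^ 18 * highPart v - lowPart v) := by
    have : u ^ 18 * highPart u = lowPart u := by linarith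
    rw [this] at d
    linarith
  exact (mul_pos_iff_of_pos_left (by positivity : 0 < u ^ 17)).1 e

theorem aeval_h_one : aeval (1 : ℝ) h = 2401 := by
  rw [aeval_h]
  norm_num

theorem h_root_unique {r t : ℝ} (hr : r ∈ Set.Ioc (0 : ℝ) 1) (ht : t ∈ Set.Ioc (0 : ℝ) 1)
    (hhr : aeval r h = 0) (hht : aeval t h = 0) : r = t := by
  have key : ∀ s ∈ Set.Ioc (0 : ℝ) 1, aeval s h = 0 → ∃ u : ℝ, 0 < u ∧ s = u / (1 + u) ∧
      u ^ 18 * highPart u - lowPart u = 0 := by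
    intro s hs h0
    have hs1 : s < 1 := by
      refine lt_of_le_of_ne hs.2 ?_
      rintro rfl
      rw [aeval_h_one] at h0
      norm_num at h0
    have h1 : 0 < 1 - s := by linarith
    -- The inverse of `u ↦ u / (1 + u)`; the endpoint `s = 1` had to be excluded first.
    have hu : 0 < s / (1 - s) := div_pos hs.1 h1
    have hsu : s = s / (1 - s) / (1 + s / (1 - s)) := by
      field_simp
      ring
    refine ⟨s / (1 - s), hu, hsu, ?_⟩
    rw [← aeval_h_div_one_add hu, ← hsu, h0, mul_zero]
  obtain ⟨u, hu, rfl, h1⟩ := key r hr hhr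
  obtain ⟨v, hv, rfl, h2⟩ := key t ht hht
  rcases lt_trichotomy u v with huv | rfl | huv
  · exact absurd h2 (homogenized_root_unique hu huv h1).ne'
  · rfl
  · exact absurd h1 (homogenized_root_unique hv huv h2).ne'

/-! ### `h` as the norm of the equation for `r₁₂` -/

/-- The coefficient of `1` in the equation for `r = r₁₂` over `ℚ(√2, √(1 + (1 - r) ^ 2))`. -/
noncomputable def ratPart (r : ℝ) : ℝ :=
  256 - 1664 * r + 5056 * r ^ 2 - 8864 * r ^ 3 + 9472 * r ^ 4 - 6024 * r ^ 5 + 2128 * r ^ 6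
  - 676 * r ^ 7 + 756 * r ^ 8 - 686 * r ^ 9 + 328 * r ^ 10 - 87 * r ^ 11 + 13 * r ^ 12
  - 1 * r ^ 13

/-- The coefficient of `√2` in the equation for `r₁₂`. -/
noncomputable def sqrtTwoPart (r : ℝ) : ℝ :=
  -256 + 1792 * r - 5952 * r ^ 2 + 12480 * r ^ 3 - 18480 * r ^ 4 + 20448 * r ^ 5 - 17432 * r ^ 6
  + 11624 * r ^ 7 - 6084 * r ^ 8 + 2480 * r ^ 9 - 770 * r ^ 10 + 174 * r ^ 11 - 26 * r ^ 12
  + 2 * r ^ 13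

/-- The coefficient of `√(1 + (1 - r) ^ 2)` in the equation for `r₁₂`. -/
noncomputable def radiusPart (r : ℝ) : ℝ :=
  -256 + 1792 * r - 5440 * r ^ 2 + 9408 * r ^ 3 - 10192 * r ^ 4 + 7104 * r ^ 5 - 3096 * r ^ 6
  + 744 * r ^ 7 - 56 * r ^ 8 - 8 * r ^ 9

/-- The rational part of the norm of the equation for `r₁₂` to `ℚ(√2)`. -/
noncomputable def normRat (r : ℝ) : ℝ :=
  65536 - 720896 * r + 3981312 * r ^ 2 - 15269888 * r ^ 3 + 47460352 * r ^ 4 - 128344064 * r ^ 5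
  + 304913408 * r ^ 6 - 625968128 * r ^ 7 + 1093645824 * r ^ 8 - 1615063040 * r ^ 9
  + 2014235712 * r ^ 10 - 2125513472 * r ^ 11 + 1903715264 * r ^ 12 - 1453057984 * r ^ 13
  + 950173040 * r ^ 14 - 535896480 * r ^ 15 + 262654800 * r ^ 16 - 112574368 * r ^ 17
  + 42268300 * r ^ 18 - 13825376 * r ^ 19 + 3885500 * r ^ 20 - 918932 * r ^ 21 + 177941 * r ^ 22
  - 27174 * r ^ 23 + 3087 * r ^ 24 - 234 * r ^ 25 + 9 * r ^ 26

/-- The coefficient of `√2` in the norm of the equation for `r₁₂` to `ℚ(√2)`. -/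
noncomputable def normSqrtTwo (r : ℝ) : ℝ :=
  -131072 + 1769472 * r - 11599872 * r ^ 2 + 48857088 * r ^ 3 - 147800064 * r ^ 4
  + 340717568 * r ^ 5 - 620525568 * r ^ 6 + 914452480 * r ^ 7 - 1109159936 * r ^ 8
  + 1122330368 * r ^ 9 - 959978496 * r ^ 10 + 706080000 * r ^ 11 - 458768896 * r ^ 12
  + 274360128 * r ^ 13 - 158293888 * r ^ 14 + 90292800 * r ^ 15 - 49900352 * r ^ 16
  + 25456848 * r ^ 17 - 11444608 * r ^ 18 + 4385776 * r ^ 19 - 1398816 * r ^ 20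
  + 363468 * r ^ 21 - 75056 * r ^ 22 + 11900 * r ^ 23 - 1372 * r ^ 24 + 104 * r ^ 25
  - 4 * r ^ 26

theorem normRat_eq (r : ℝ) : normRat r =
    ratPart r ^ 2 + 2 * sqrtTwoPart r ^ 2 - radiusPart r ^ 2 * (1 + (1 - r) ^ 2) := by
  unfold normRat ratPart sqrtTwoPart radiusPart
  ring

theorem normSqrtTwo_eq (r : ℝ) : normSqrtTwo r = 2 * ratPart r * sqrtTwoPart r := by
  unfold normSqrtTwo ratPart sqrtTwoPart
  ring

theorem aeval_h_eq_norm (r : ℝ) : aeval r h = normRat r ^ 2 - 2 * normSqrtTwo r ^ 2 := by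
  rw [aeval_h]
  unfold normRat normSqrtTwo
  ring

/-- The norm is taken in two stages: multiplying by the conjugate `w ↦ -w` removes `w`, and then
multiplying by the conjugate `q ↦ -q` removes `q`. -/
theorem aeval_h_eq_zero {r q w : ℝ} (hq : q ^ 2 = 2) (hw : w ^ 2 = 1 + (1 - r) ^ 2)
    (h0 : ratPart r + sqrtTwoPart r * q + radiusPart r * w = 0) : aeval r h = 0 := by
  rw [aeval_h_eq_norm]
  have h1 : normRat r + normSqrtTwo r * q = 0 := by
    rw [normRat_eq, normSqrtTwo_eq, ← hw]
    linear_combination (ratPart r + sqrtTwoPart r * q - radiusPart r * w) * h0 -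
      sqrtTwoPart r ^ 2 * hq
  linear_combination (normRat r - normSqrtTwo r * q) * h1 + normSqrtTwo r ^ 2 * hq

/-- The equation for `r = r₁₂` obtained by eliminating the mass and the multiplier. -/
noncomputable def distEq (r : ℝ) : ℝ :=
  ratPart r + sqrtTwoPart r * √2 + radiusPart r * √(1 + (1 - r) ^ 2)

theorem aeval_h_of_distEq {r : ℝ} (h0 : distEq r = 0) : aeval r h = 0 :=
  aeval_h_eq_zero (Real.sq_sqrt (by norm_num)) (Real.sq_sqrt (by positivity)) h0

theorem continuous_distEq : Continuous distEq := by
  unfold distEq ratPart sqrtTwoPart radiusPart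
  fun_prop

/-! ### Numerical location of the zero -/

theorem sqrt_mem_Icc {x a b : ℝ} (hb : 0 ≤ b) (h1 : a ^ 2 ≤ x) (h2 : x ≤ b ^ 2) :
    √x ∈ Set.Icc a b :=
  ⟨Real.le_sqrt_of_sq_le h1, Real.sqrt_le_iff.2 ⟨hb, h2⟩⟩

theorem sqrt_two_mem_Icc : √2 ∈ Set.Icc (1.41421356237309504880 : ℝ) 1.41421356237309504881 :=
  sqrt_mem_Icc (by norm_num) (by norm_num) (by norm_num)

theorem exists_distEq_eq_zero :
    ∃ r ∈ Set.Icc (0.4402418528707 : ℝ) 0.4402418528708, distEq r = 0 := by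
  obtain ⟨hq1, hq2⟩ := sqrt_two_mem_Icc
  have hlow : distEq 0.4402418528707 ≤ 0 := by
    obtain ⟨hw1, hw2⟩ : √(1 + (1 - 0.4402418528707) ^ 2) ∈
        Set.Icc (1.146005751851894967 : ℝ) 1.146005751851894968 :=
      sqrt_mem_Icc (by norm_num) (by norm_num) (by norm_num)
    unfold distEq
    -- Both radicals have nonpositive coefficients here, so their lower bounds give an upper bound
    -- for `distEq`; at the other endpoint the roles are exchanged.
    have e1 : sqrtTwoPart 0.4402418528707 ≤ 0 := by unfold sqrtTwoPart; norm_num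
    have e2 : radiusPart 0.4402418528707 ≤ 0 := by unfold radiusPart; norm_num
    have a1 := mul_le_mul_of_nonpos_left hq1 e1
    have a2 := mul_le_mul_of_nonpos_left hw1 e2
    have a3 : ratPart 0.4402418528707 + sqrtTwoPart 0.4402418528707 * 1.41421356237309504880 +
        radiusPart 0.4402418528707 * 1.146005751851894967 ≤ 0 := by
      unfold ratPart sqrtTwoPart radiusPart; norm_num
    linarith
  have hhigh : 0 ≤ distEq 0.4402418528708 := by
    obtain ⟨hw1, hw2⟩ : √(1 + (1 - 0.4402418528708) ^ 2) ∈
        Set.Icc (1.146005751851846123 : ℝ) 1.146005751851846124 :=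
      sqrt_mem_Icc (by norm_num) (by norm_num) (by norm_num)
    unfold distEq
    have e1 : sqrtTwoPart 0.4402418528708 ≤ 0 := by unfold sqrtTwoPart; norm_num
    have e2 : radiusPart 0.4402418528708 ≤ 0 := by unfold radiusPart; norm_num
    have a1 := mul_le_mul_of_nonpos_left hq2 e1
    have a2 := mul_le_mul_of_nonpos_left hw2 e2
    have a3 : 0 ≤ ratPart 0.4402418528708 + sqrtTwoPart 0.4402418528708 * 1.41421356237309504881 +
        radiusPart 0.4402418528708 * 1.146005751851846124 := by
      unfold ratPart sqrtTwoPart radiusPart; norm_num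
    linarith
  exact intermediate_value_Icc (by norm_num) continuous_distEq.continuousOn ⟨hlow, hhigh⟩

/-! ### Elimination of the mass and its numerical value -/

/-- With `massDen`, the equations of the bodies `x₁, x₂` say `m₅ * massDen r = massNum r`. -/
noncomputable def massNum (r : ℝ) : ℝ :=
  (2 - r) / r ^ 2 - r / (2 - r) ^ 2 + (1 - r) / 4 - 1 / (4 * (1 - r) ^ 2)

/-- The denominator of the mass determined by the equations of the bodies `x₁, x₂`. -/
noncomputable def massDen (r : ℝ) : ℝ :=
  √2 / (2 * (1 - r) ^ 2) - 2 * (1 - r) / √(1 + (1 - r) ^ 2) ^ 3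

/-- With `massDen'`, the equations of the bodies `x₁, x₅` say `m₅ * massDen' r = massNum' r`. -/
noncomputable def massNum' (r : ℝ) : ℝ :=
  1 / r ^ 2 + 1 / (2 - r) ^ 2 + 1 / 4 - 2 / √(1 + (1 - r) ^ 2) ^ 3 - √2 / (2 * (1 - r) ^ 3)

/-- The denominator of the mass determined by the equations of the bodies `x₁, x₅`. -/
noncomputable def massDen' (r : ℝ) : ℝ :=
  1 / (4 * (1 - r) ^ 3) - 2 / √(1 + (1 - r) ^ 2) ^ 3

/-- The compatibility determinant of the two mass equations, cleared of denominators. The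
contributions of `√2 * √(1 + (1 - r) ^ 2)` cancel, which is why `distEq` needs only three
coefficients. -/
theorem elimination_eq {r : ℝ} (h0 : 0 < r) (h1 : r < 1) :
    16 * (1 - r) ^ 5 * r ^ 2 * (2 - r) ^ 2 * (1 + (1 - r) ^ 2) ^ 3 *
      (massNum r * massDen' r - massDen r * massNum' r) = distEq r := by
  have ht : 1 - r ≠ 0 := by linarith
  have hT : 2 - r ≠ 0 := by linarith
  have hU : (1 + (1 - r) ^ 2) ≠ 0 := by positivity
  have hr : r ≠ 0 := h0.ne'
  unfold massNum massNum' massDen massDen' distEq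
  have hq : √2 ^ 2 = 2 := Real.sq_sqrt (by norm_num)
  have hw : √(1 + (1 - r) ^ 2) ^ 2 = 1 + (1 - r) ^ 2 := Real.sq_sqrt (by positivity)
  have hw0 : √(1 + (1 - r) ^ 2) ≠ 0 := by positivity
  generalize √2 = q at *
  generalize √(1 + (1 - r) ^ 2) = w at *
  -- Rationalizing makes every denominator a polynomial in `r`; only `q ^ 2` and `w ^ 2` then have
  -- to be reduced at the end.
  have hinv : ∀ y : ℝ, y / w ^ 3 = y * w / (1 + (1 - r) ^ 2) ^ 2 := by
    intro y
    rw [← hw]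
    field_simp
  rw [hinv, hinv]
  have hA : (2 - r) / r ^ 2 - r / (2 - r) ^ 2 + (1 - r) / 4 - 1 / (4 * (1 - r) ^ 2) =
      (4 * (1 - r) ^ 2 * (2 - r) ^ 3 - 4 * (1 - r) ^ 2 * r ^ 3 -
        (1 - (1 - r) ^ 3) * r ^ 2 * (2 - r) ^ 2) / (4 * (1 - r) ^ 2 * r ^ 2 * (2 - r) ^ 2) := by
    field_simp
    ring
  have hB : q / (2 * (1 - r) ^ 2) - 2 * (1 - r) * w / (1 + (1 - r) ^ 2) ^ 2 =
      (q * (1 + (1 - r) ^ 2) ^ 2 - 4 * (1 - r) ^ 3 * w) /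
        (2 * (1 - r) ^ 2 * (1 + (1 - r) ^ 2) ^ 2) := by
    field_simp
    ring
  have hC : 1 / r ^ 2 + 1 / (2 - r) ^ 2 + 1 / 4 - 2 * w / (1 + (1 - r) ^ 2) ^ 2 -
      q / (2 * (1 - r) ^ 3) =
      ((1 - r) ^ 3 * (1 + (1 - r) ^ 2) ^ 2 * (4 * (2 - r) ^ 2 + 4 * r ^ 2 + r ^ 2 * (2 - r) ^ 2) -
        8 * (1 - r) ^ 3 * r ^ 2 * (2 - r) ^ 2 * w -
        2 * q * r ^ 2 * (2 - r) ^ 2 * (1 + (1 - r) ^ 2) ^ 2) /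
      (4 * (1 - r) ^ 3 * r ^ 2 * (2 - r) ^ 2 * (1 + (1 - r) ^ 2) ^ 2) := by
    field_simp
    ring
  have hD : 1 / (4 * (1 - r) ^ 3) - 2 * w / (1 + (1 - r) ^ 2) ^ 2 =
      ((1 + (1 - r) ^ 2) ^ 2 - 8 * (1 - r) ^ 3 * w) /
        (4 * (1 - r) ^ 3 * (1 + (1 - r) ^ 2) ^ 2) := by
    field_simp
    ring
  rw [hA, hB, hC, hD, div_mul_div_comm, div_mul_div_comm, div_sub_div _ _ (by positivity)
    (by positivity), mul_div_assoc', div_eq_iff (by positivity)]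
  unfold ratPart sqrtTwoPart radiusPart
  linear_combination 128 * (1 - r) ^ 10 * r ^ 4 * (2 - r) ^ 4 * (1 + (1 - r) ^ 2) ^ 5 *
    (4 * r ^ 2 * (2 - r) ^ 2 * (1 + (1 - r) ^ 2) ^ 4 * hq -
      64 * (1 - r) ^ 6 * r ^ 2 * (2 - r) ^ 2 * hw)

/-- Geometrically, `x₅` is closer to `x₂` than to `x₁`: `√2 * (1 - r) < √(1 + (1 - r) ^ 2)`. If the
second distance is replaced by the first, the two terms of `massDen` become equal. -/
theorem massDen_pos {r : ℝ} (h0 : 0 < r) (h1 : r < 1) : 0 < massDen r := by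
  have ht : 0 < 1 - r := by linarith
  have hq : √2 ^ 2 = 2 := Real.sq_sqrt (by norm_num)
  have hq0 : 0 < √2 := by positivity
  have hlt : √2 * (1 - r) < √(1 + (1 - r) ^ 2) := by
    refine Real.lt_sqrt_of_sq_lt ?_
    rw [mul_pow, hq]
    nlinarith
  have h2 : 2 * (1 - r) / √(1 + (1 - r) ^ 2) ^ 3 < 2 * (1 - r) / (√2 * (1 - r)) ^ 3 := by
    gcongr
  have h3 : 2 * (1 - r) / (√2 * (1 - r)) ^ 3 = √2 / (2 * (1 - r) ^ 2) := by
    rw [div_eq_div_iff (by positivity) (by positivity)]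
    linear_combination -(1 - r) ^ 3 * (√2 ^ 2 + 2) * hq
  unfold massDen
  linarith

theorem massNum_anti {r s : ℝ} (h0 : 0 < r) (hrs : r ≤ s) (h1 : s < 1) :
    massNum s ≤ massNum r := by
  have hs : 0 < 1 - s := by linarith
  have hs2 : 0 < 2 - s := by linarith
  have hs2' : 0 ≤ 2 - r := by linarith
  have hs0 : 0 ≤ s := by linarith
  unfold massNum
  gcongr

theorem mass_mem_Ico {r : ℝ} (hr : r ∈ Set.Icc (0.4402418528707 : ℝ) 0.4402418528708) :
    massNum r / massDen r ∈ Set.Ico (4.76482836 : ℝ) 4.76482837 := by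
  obtain ⟨h1, h2⟩ := hr
  obtain ⟨hq1, hq2⟩ := sqrt_two_mem_Icc
  have hden := massDen_pos (r := r) (by linarith) (by linarith)
  have hnum1 := massNum_anti (by norm_num) h1 (by linarith)
  have hnum2 := massNum_anti (by linarith) h2 (by norm_num)
  have ht1 : (0.5597581471292 : ℝ) ≤ 1 - r := by linarith
  have ht2 : 1 - r ≤ (0.5597581471293 : ℝ) := by linarith
  obtain ⟨hw1, hw2⟩ : √(1 + (1 - r) ^ 2) ∈
      Set.Icc (1.146005751851 : ℝ) 1.146005751852 :=
    sqrt_mem_Icc (by norm_num) (by nlinarith) (by nlinarith)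
  have hden1 : √2 / (2 * (1 - r) ^ 2) ≤ 1.41421356237309504881 / (2 * 0.5597581471292 ^ 2) := by
    gcongr
  have hden2 : (1.41421356237309504880 : ℝ) / (2 * 0.5597581471293 ^ 2) ≤
      √2 / (2 * (1 - r) ^ 2) := by
    gcongr
  have hden3 : 2 * (1 - r) / √(1 + (1 - r) ^ 2) ^ 3 ≤
      2 * 0.5597581471293 / 1.146005751851 ^ 3 := by
    gcongr
  have hden4 : 2 * 0.5597581471292 / 1.146005751852 ^ 3 ≤
      2 * (1 - r) / √(1 + (1 - r) ^ 2) ^ 3 := by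
    gcongr
  -- The bracket is the lower bound for `massDen r` from `hden2` and `hden3`. The factor lies below
  -- `4.76482837`, so positivity of `massDen r` makes the final bound strict.
  have hn1 : massNum 0.4402418528707 ≤ 4.764828365 *
      (1.41421356237309504880 / (2 * 0.5597581471293 ^ 2) -
        2 * 0.5597581471293 / 1.146005751851 ^ 3) := by
    unfold massNum; norm_num
  have hn2 : 4.764828361 * (1.41421356237309504881 / (2 * 0.5597581471292 ^ 2) -
        2 * 0.5597581471292 / 1.146005751852 ^ 3) ≤ massNum 0.4402418528708 := by
    unfold massNum; norm_num
  rw [Set.mem_Ico, le_div_iff₀ hden, div_lt_iff₀ hden]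
  have e : massDen r = √2 / (2 * (1 - r) ^ 2) - 2 * (1 - r) / √(1 + (1 - r) ^ 2) ^ 3 := rfl
  constructor <;> linarith

/-! ### The equations of motion on the one-parameter family -/

/-- The equations of the bodies `x₁`, `x₂`, `x₅`, with multiplier `l` and `μ = m₅ = m₆`. -/
def BodyEquations (μ l r : ℝ) : Prop :=
  l = (r ^ 3)⁻¹ * r + ((2 - r) ^ 3)⁻¹ * (2 - r) + 1 / 4 + 2 * μ * (√(1 + (1 - r) ^ 2) ^ 3)⁻¹ ∧
  l * (1 - r) = -((r ^ 3)⁻¹ * r) + ((2 * (1 - r)) ^ 3)⁻¹ * (2 * (1 - r)) +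
    ((2 - r) ^ 3)⁻¹ * (2 - r) + 2 * μ * ((√2 * (1 - r)) ^ 3)⁻¹ * (1 - r) ∧
  l = 2 * (√(1 + (1 - r) ^ 2) ^ 3)⁻¹ + 2 * ((√2 * (1 - r)) ^ 3)⁻¹ +
    2 * μ * ((2 * (1 - r)) ^ 3)⁻¹

theorem bodyEquations_iff {μ l r : ℝ} (h0 : 0 < r) (h1 : r < 1) :
    BodyEquations μ l r ↔
      l = 1 / r ^ 2 + 1 / (2 - r) ^ 2 + 1 / 4 + 2 * μ / √(1 + (1 - r) ^ 2) ^ 3 ∧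
      μ * massDen r = massNum r ∧ μ * massDen' r = massNum' r := by
  have ht : 0 < 1 - r := by linarith
  have hT : 0 < 2 - r := by linarith
  have hq : √2 ^ 2 = 2 := Real.sq_sqrt (by norm_num)
  have hq0 : √2 ≠ 0 := by positivity
  have a1 : (r ^ 3)⁻¹ * r = 1 / r ^ 2 := by field_simp
  have a2 : ((2 - r) ^ 3)⁻¹ * (2 - r) = 1 / (2 - r) ^ 2 := by field_simp
  have a3 : ((2 * (1 - r)) ^ 3)⁻¹ * (2 * (1 - r)) = 1 / (4 * (1 - r) ^ 2) := by
    field_simp; norm_num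
  have a4 : 2 * ((2 * (1 - r)) ^ 3)⁻¹ = 1 / (4 * (1 - r) ^ 3) := by field_simp; norm_num
  have a5 : 2 * ((√2 * (1 - r)) ^ 3)⁻¹ = √2 / (2 * (1 - r) ^ 3) := by
    rw [← div_eq_mul_inv, div_eq_div_iff (by positivity) (by positivity)]
    linear_combination -(1 - r) ^ 3 * (√2 ^ 2 + 2) * hq
  have a6 : √2 / (2 * (1 - r) ^ 3) * (1 - r) = √2 / (2 * (1 - r) ^ 2) := by field_simp
  have b2 : 2 * μ * ((√2 * (1 - r)) ^ 3)⁻¹ * (1 - r) = μ * (√2 / (2 * (1 - r) ^ 2)) := by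
    rw [← a6, ← a5]; ring
  have b5 : 2 * μ * ((2 * (1 - r)) ^ 3)⁻¹ = μ * (1 / (4 * (1 - r) ^ 3)) := by rw [← a4]; ring
  unfold BodyEquations massDen massDen' massNum massNum'
  rw [a1, a2, a3, a5, b2, b5, ← div_eq_mul_inv, ← div_eq_mul_inv]
  generalize √(1 + (1 - r) ^ 2) ^ 3 = w
  generalize √2 / (2 * (1 - r) ^ 2) = x
  generalize √2 / (2 * (1 - r) ^ 3) = x'
  generalize 1 / (4 * (1 - r) ^ 2) = y
  generalize 1 / (4 * (1 - r) ^ 3) = y'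
  simp only [div_eq_mul_inv]
  generalize ((2 - r) ^ 2)⁻¹ = z
  generalize (r ^ 2)⁻¹ = z'
  constructor
  · rintro ⟨e1, e2, e5⟩
    refine ⟨e1, ?_, ?_⟩
    · linear_combination (1 - r) * e1 - e2
    · linear_combination e1 - e5
  · rintro ⟨e1, e2, e5⟩
    refine ⟨e1, ?_, ?_⟩
    · linear_combination (1 - r) * e1 - e2
    · linear_combination e1 - e5

/-- The first body equation merely defines `l`. The other two are linear in `μ`, and as `massDen r ≠
0` they are jointly solvable exactly when their determinant vanishes. -/
theorem exists_bodyEquations_iff {μ r : ℝ} (h0 : 0 < r) (h1 : r < 1) :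
    (∃ l, BodyEquations μ l r) ↔ distEq r = 0 ∧ μ = massNum r / massDen r := by
  have ht : 0 < 1 - r := by linarith
  have hT : 0 < 2 - r := by linarith
  have hd := massDen_pos h0 h1
  have hf : distEq r = 0 ↔ massNum r * massDen' r - massDen r * massNum' r = 0 := by
    rw [← elimination_eq h0 h1, mul_eq_zero, or_iff_right (by positivity)]
  rw [hf, eq_div_iff hd.ne']
  constructor
  · rintro ⟨l, hl⟩
    obtain ⟨-, e2, e5⟩ := (bodyEquations_iff h0 h1).1 hl
    refine ⟨?_, e2⟩
    linear_combination massDen r * e5 - massDen' r * e2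
  · rintro ⟨h, e2⟩
    refine ⟨_, (bodyEquations_iff h0 h1).2 ⟨rfl, e2, ?_⟩⟩
    refine mul_left_cancel₀ hd.ne' ?_
    linear_combination massDen' r * e2 + h

theorem multiplier_pos {μ l r : ℝ} (h0 : 0 < r) (h1 : r < 1) (hμ : 0 < μ)
    (h : BodyEquations μ l r) : 0 < l := by
  have hT : 0 < 2 - r := by linarith
  rw [h.1]
  positivity

/-- The configuration of four collinear bodies with `r₁₂ = r₃₄ = r`, `r₁₄ = 2` on the `y`-axis,
completed by two bodies on the `x`-axis to a square with the two inner ones. -/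
noncomputable def squareCross (r : ℝ) : Fin 6 → Plane :=
  ![!₂[0, 1], !₂[0, 1 - r], !₂[0, -(1 - r)], !₂[0, -1], !₂[-(1 - r), 0], !₂[1 - r, 0]]

theorem dist_plane {a b c d e : ℝ} (he : 0 ≤ e) (h : (a - c) ^ 2 + (b - d) ^ 2 = e ^ 2) :
    dist (!₂[a, b] : Plane) !₂[c, d] = e := by
  rw [EuclideanSpace.dist_eq, Fin.sum_univ_two]
  simp only [Real.dist_eq, sq_abs]
  simp [h, Real.sqrt_sq he]

/-- The mutual distances of `squareCross r`. -/
noncomputable def squareCrossDist (r : ℝ) : Fin 6 → Fin 6 → ℝ :=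
  ![![0, r, 2 - r, 2, √(1 + (1 - r) ^ 2), √(1 + (1 - r) ^ 2)],
    ![r, 0, 2 * (1 - r), 2 - r, √2 * (1 - r), √2 * (1 - r)],
    ![2 - r, 2 * (1 - r), 0, r, √2 * (1 - r), √2 * (1 - r)],
    ![2, 2 - r, r, 0, √(1 + (1 - r) ^ 2), √(1 + (1 - r) ^ 2)],
    ![√(1 + (1 - r) ^ 2), √2 * (1 - r), √2 * (1 - r), √(1 + (1 - r) ^ 2), 0, 2 * (1 - r)],
    ![√(1 + (1 - r) ^ 2), √2 * (1 - r), √2 * (1 - r), √(1 + (1 - r) ^ 2), 2 * (1 - r), 0]]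

theorem dist_squareCross {r : ℝ} (h0 : 0 < r) (h1 : r < 1) (i j : Fin 6) :
    dist (squareCross r i) (squareCross r j) = squareCrossDist r i j := by
  have ht : 0 < 1 - r := by linarith
  have hT : 0 < 2 - r := by linarith
  have hq : √2 ^ 2 = 2 := Real.sq_sqrt (by norm_num)
  have hw : √(1 + (1 - r) ^ 2) ^ 2 = 1 + (1 - r) ^ 2 := Real.sq_sqrt (by positivity)
  fin_cases i <;> fin_cases j <;>
    refine dist_plane ?_ ?_ <;>
    simp only [squareCrossDist, Fin.reduceFinMk, Fin.zero_eta, Fin.mk_one, Matrix.cons_val,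
      Matrix.cons_val_zero, Matrix.cons_val_one] <;>
    first
    | positivity
    | linear_combination
    | linear_combination -hw
    | linear_combination -(1 - r) ^ 2 * hq

/-- Symmetry in both axes makes each of the twelve scalar equations trivial or, up to sign, one of
three: the ordinates for `x₁` and `x₂` and the abscissa for `x₆`, the last being `1 - r` times the
third equation of `BodyEquations`. -/
theorem central_equations_iff {μ l r : ℝ} (h0 : 0 < r) (h1 : r < 1) :
    (∀ i, ∑ j ∈ Finset.univ.erase i,
        ((![1, 1, 1, 1, μ, μ] : Fin 6 → ℝ) j *
          (dist (squareCross r i) (squareCross r j) ^ 3)⁻¹) •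
            (squareCross r j - squareCross r i) + l • (squareCross r i - 0) = 0) ↔
      BodyEquations μ l r := by
  have hsum : ∀ i, ∑ j ∈ Finset.univ.erase i,
        ((![1, 1, 1, 1, μ, μ] : Fin 6 → ℝ) j *
          (dist (squareCross r i) (squareCross r j) ^ 3)⁻¹) •
            (squareCross r j - squareCross r i) =
      ∑ j, ((![1, 1, 1, 1, μ, μ] : Fin 6 → ℝ) j * (squareCrossDist r i j ^ 3)⁻¹) •
            (squareCross r j - squareCross r i) := by
    intro i
    rw [Finset.sum_erase _ (by simp)]
    simp only [dist_squareCross h0 h1]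
  simp only [hsum]
  have ht : 1 - r ≠ 0 := by linarith
  unfold BodyEquations
  constructor
  · intro h
    have e1 := congrArg (fun p : Plane ↦ p 1) (h 0)
    have e2 := congrArg (fun p : Plane ↦ p 1) (h 1)
    have e5 := congrArg (fun p : Plane ↦ p 0) (h 5)
    simp [Fin.sum_univ_six, squareCross, squareCrossDist, -inv_pow] at e1 e2 e5
    refine ⟨by linear_combination e1, by linear_combination e2, mul_right_cancel₀ ht ?_⟩
    linear_combination e5
  · rintro ⟨e1, e2, e5⟩ i
    ext k
    fin_cases i <;> fin_cases k <;> simp [Fin.sum_univ_six, squareCross, squareCrossDist, -inv_pow]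
    all_goals
      first
      | linear_combination e1
      | linear_combination -e1
      | linear_combination e2
      | linear_combination -e2
      | linear_combination (1 - r) * e5
      | linear_combination -(1 - r) * e5
      | linear_combination

/-! ### Reduction of an admissible configuration to the family -/

theorem plane_ext {p q : Plane} (h0 : p 0 = q 0) (h1 : p 1 = q 1) : p = q := by
  ext k
  fin_cases k
  exacts [h0, h1]

theorem norm_sq_plane (p : Plane) : ‖p‖ ^ 2 = p 0 ^ 2 + p 1 ^ 2 := by
  rw [EuclideanSpace.norm_sq_eq, Fin.sum_univ_two]
  simp [sq_abs]

theorem dist_of_fst_eq {p q : Plane} (h : p 0 = q 0) : dist p q = |p 1 - q 1| := by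
  rw [EuclideanSpace.dist_eq, Fin.sum_univ_two, h, dist_self, Real.dist_eq]
  simp [Real.sqrt_sq_eq_abs]

theorem IsSquareVertexSet.norm_eq {S : Set Plane} (hS : IsSquareVertexSet 0 S) {p q : Plane}
    (hp : p ∈ S) (hq : q ∈ S) : ‖p‖ = ‖q‖ := by
  obtain ⟨u, v, -, huv, -, rfl⟩ := hS
  have key : ∀ x ∈ ({0 + u, 0 - u, 0 + v, 0 - v} : Set Plane), ‖x‖ = ‖u‖ := by
    rintro x (rfl | rfl | rfl | rfl) <;> simp [huv]
  rw [key p hp, key q hq]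

theorem fst_eq_zero_of_collinear {s : Set Plane} (hs : Collinear ℝ s) {p q x : Plane}
    (hp : p ∈ s) (hq : q ∈ s) (hx : x ∈ s) (hp0 : p 0 = 0) (hq0 : q 0 = 0) (hpq : p 1 ≠ q 1) :
    x 0 = 0 := by
  obtain ⟨p₀, v, h⟩ := (collinear_iff_exists_forall_eq_smul_vadd s).1 hs
  obtain ⟨a, rfl⟩ := h p hp
  obtain ⟨b, rfl⟩ := h q hq
  obtain ⟨c, rfl⟩ := h x hx
  simp at hp0 hq0 hpq ⊢
  have hab : a ≠ b := fun hab ↦ hpq.1 hab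
  have hv : v 0 = 0 := by
    have : (a - b) * v 0 = 0 := by linear_combination hp0 - hq0
    exact (mul_eq_zero.1 this).resolve_left (sub_ne_zero.2 hab)
  rw [hv, mul_zero, zero_add] at hp0 ⊢
  exact hp0

/-- The scale condition puts `x₄` at height `-1`, then `r₁₄ = 2` puts `x₁` at height `1`, and `r₁₂ =
r₃₄` makes `x₂, x₃` opposite. Of the square only the equal distances to the centre are used; they
fix `x₅, x₆` up to sign. -/
theorem IsSquareCross.exists_eq_squareCross {m : Fin 6 → ℝ} {x : Fin 6 → Plane}
    (hx : IsSquareCross m x) : ∃ r : ℝ, 0 < r ∧ r < 1 ∧ x = squareCross r := by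
  obtain ⟨hn, hcol, hsq, ⟨hy1, hy2⟩, ⟨hx4, hx5⟩, hd12, hd14⟩ := hx
  have o12 := hn.order₁₂
  have o23 := hn.order₂₃
  have o34 := hn.order₃₄
  have hab := hn.above
  have hsc := hn.scale
  have hl := hn.left
  have hr := hn.right
  have hy0 : x 0 0 = 0 := fst_eq_zero_of_collinear hcol (p := x 1) (q := x 2) (by simp) (by simp)
    (by simp) hy1 hy2 o23.ne'
  have hy3 : x 3 0 = 0 := fst_eq_zero_of_collinear hcol (p := x 1) (q := x 2) (by simp) (by simp)
    (by simp) hy1 hy2 o23.ne'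
  rw [dist_of_fst_eq (by rw [hy0, hy3]), abs_of_pos (by linarith)] at hd14
  rw [dist_of_fst_eq (by rw [hy0, hy1]), dist_of_fst_eq (by rw [hy2, hy3]),
    abs_of_pos (by linarith), abs_of_pos (by linarith)] at hd12
  have n4 : ‖x 4‖ ^ 2 = ‖x 2‖ ^ 2 := by rw [hsq.norm_eq (p := x 4) (q := x 2) (by simp) (by simp)]
  have n5 : ‖x 5‖ ^ 2 = ‖x 2‖ ^ 2 := by rw [hsq.norm_eq (p := x 5) (q := x 2) (by simp) (by simp)]
  rw [norm_sq_plane, norm_sq_plane, hy2, hx4] at n4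
  rw [norm_sq_plane, norm_sq_plane, hy2, hx5] at n5
  -- The squares agree by `n4`, and both numbers are negative: `x 4 0 < x 0 0 = 0` and `x 2 1 < x 4
  -- 1 = 0`.
  have e4 : x 4 0 = x 2 1 := by nlinarith
  have e5 : x 5 0 = -x 2 1 := by nlinarith
  refine ⟨1 - x 1 1, by linarith, by linarith, ?_⟩
  funext i
  fin_cases i <;> refine plane_ext ?_ ?_ <;> simp [squareCross] <;> linarith

/-! ### Admissibility of the family -/

theorem squareCross_injective {r : ℝ} (h0 : 0 < r) (h1 : r < 1) :
    Function.Injective (squareCross r) := by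
  intro i j hij
  have hd := dist_squareCross h0 h1 i j
  rw [hij, dist_self] at hd
  have ht : 0 < 1 - r := by linarith
  have hT : 0 < 2 - r := by linarith
  have hw : 0 < √(1 + (1 - r) ^ 2) := by positivity
  have hq : 0 < √2 * (1 - r) := by positivity
  by_contra hne
  revert hd
  fin_cases i <;> fin_cases j <;>
    simp only [squareCrossDist, Fin.reduceFinMk, Fin.zero_eta, Fin.mk_one, Matrix.cons_val,
      Matrix.cons_val_zero, Matrix.cons_val_one] <;>
    first
    | exact absurd rfl hne
    | (intro hd; linarith)

theorem affineSpan_squareCross {r : ℝ} (h1 : r < 1) :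
    affineSpan ℝ (Set.range (squareCross r)) = ⊤ := by
  have ht : 1 - r ≠ 0 := by linarith
  rw [AffineSubspace.affineSpan_eq_top_iff_vectorSpan_eq_top_of_nonempty ℝ Plane Plane
    (Set.range_nonempty _), eq_top_iff]
  intro v _
  have hv : v = (v 1 / 2) • (squareCross r 0 -ᵥ squareCross r 3) +
      (v 0 / (2 * (1 - r))) • (squareCross r 5 -ᵥ squareCross r 4) := by
    refine plane_ext ?_ ?_
    · simp [squareCross]
      field_simp
      ring
    · simp [squareCross]
      ring
  rw [hv]
  exact add_mem
    (Submodule.smul_mem _ _ (vsub_mem_vectorSpan ℝ (Set.mem_range_self 0) (Set.mem_range_self 3)))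
    (Submodule.smul_mem _ _ (vsub_mem_vectorSpan ℝ (Set.mem_range_self 5) (Set.mem_range_self 4)))

theorem squareCross_neg (r : ℝ) : squareCross r 4 = -squareCross r 5 := by
  refine plane_ext ?_ ?_ <;> simp [squareCross]

/-- The second coordinate axis. -/
noncomputable def ordinateAxis : AffineSubspace ℝ Plane :=
  (ℝ ∙ (!₂[0, 1] : Plane)).toAffineSubspace

theorem mem_ordinateAxis {p : Plane} : p ∈ ordinateAxis ↔ p 0 = 0 := by
  rw [ordinateAxis, Submodule.mem_toAffineSubspace, Submodule.mem_span_singleton]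
  constructor
  · rintro ⟨a, rfl⟩
    simp
  · intro h
    exact ⟨p 1, plane_ext (by simp [h]) (by simp)⟩

theorem isSymmetryLine_ordinateAxis (r : ℝ) :
    IsSymmetryLine ordinateAxis (Set.range (squareCross r)) := by
  have hdir : ordinateAxis.direction = ℝ ∙ (!₂[0, 1] : Plane) :=
    Submodule.toAffineSubspace_direction _
  refine ⟨?_, ?_⟩
  · rw [hdir, finrank_span_singleton]
    intro h
    simpa using congrArg (fun p : Plane ↦ p 1) h
  have h0 : (0 : Plane) ∈ ordinateAxis := mem_ordinateAxis.2 rfl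
  have : Nonempty ordinateAxis := ⟨⟨0, h0⟩⟩
  refine ⟨this, ?_⟩
  have h5 : EuclideanGeometry.reflection ordinateAxis (squareCross r 5) = squareCross r 4 := by
    have hv : squareCross r 5 ∈ ordinateAxis.directionᗮ := by
      rw [hdir, Submodule.mem_orthogonal_singleton_iff_inner_right]
      simp [squareCross, PiLp.inner_apply]
    have := EuclideanGeometry.reflection_orthogonal_vadd h0 hv
    rw [squareCross_neg]
    simpa using this
  have h4 : EuclideanGeometry.reflection ordinateAxis (squareCross r 4) = squareCross r 5 := by
    rw [← h5, EuclideanGeometry.reflection_reflection]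
  -- Reflection in the axis acts on the bodies as the transposition of `x₅` and `x₆`, so the image
  -- of the configuration is unchanged.
  have hcomp : EuclideanGeometry.reflection ordinateAxis ∘ squareCross r =
      squareCross r ∘ Equiv.swap 4 5 := by
    funext i
    by_cases hi4 : i = 4
    · subst hi4
      simpa using h4
    by_cases hi5 : i = 5
    · subst hi5
      simpa using h5
    rw [Function.comp_apply, Function.comp_apply, Equiv.swap_apply_of_ne_of_ne hi4 hi5,
      EuclideanGeometry.reflection_eq_self_iff, mem_ordinateAxis]
    fin_cases i <;> simp [squareCross] at hi4 hi5 ⊢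
  rw [← Set.range_comp, hcomp, (Equiv.swap (4 : Fin 6) 5).surjective.range_comp]

theorem centerMass_squareCross (μ r : ℝ) :
    Finset.univ.centerMass (![1, 1, 1, 1, μ, μ] : Fin 6 → ℝ) (squareCross r) = 0 := by
  rw [Finset.centerMass]
  convert smul_zero _
  refine plane_ext ?_ ?_ <;> simp [Fin.sum_univ_six, squareCross] <;> ring

theorem isSquareCross_squareCross {μ l r : ℝ} (h0 : 0 < r) (h1 : r < 1) (hμ : 0 < μ)
    (h : BodyEquations μ l r) : IsSquareCross ![1, 1, 1, 1, μ, μ] (squareCross r) := by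
  have hc := centerMass_squareCross μ r
  refine ⟨⟨⟨⟨squareCross_injective h0 h1, ?_, l, (multiplier_pos h0 h1 hμ h).ne', ?_⟩,
    affineSpan_squareCross h1, ordinateAxis, isSymmetryLine_ordinateAxis r, ?_⟩, hc,
    ?_, ?_, ?_, ?_, ?_, ?_, ?_, ?_⟩, ?_, ?_, ?_, ?_, ?_, ?_⟩
  · simp [Fin.sum_univ_six]
    linarith
  · rw [hc]
    exact (central_equations_iff h0 h1).2 h
  · intro i
    rw [mem_ordinateAxis]
    have ht : 1 - r ≠ 0 := by linarith
    fin_cases i <;> simp [squareCross]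
    · intro h; exact ht (by linarith)
    · exact ht
  · simp [squareCross]
  · simp [squareCross]; linarith
  · simp [squareCross]; linarith
  · simp [squareCross]; linarith
  · simp [squareCross]; linarith
  · simp [squareCross]
  · simp [squareCross]; linarith
  · simp [squareCross]; linarith
  · rw [collinear_iff_exists_forall_eq_smul_vadd]
    refine ⟨0, !₂[0, 1], ?_⟩
    rintro p hp
    refine ⟨p 1, plane_ext ?_ (by simp)⟩
    rcases hp with rfl | rfl | rfl | rfl <;> simp [squareCross]
  · refine ⟨squareCross r 1, squareCross r 5, ?_, ?_, ?_, ?_⟩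
    · intro h
      have : 1 - r = 0 := by simpa [squareCross] using congrArg (fun p : Plane ↦ p 1) h
      linarith
    · rw [← sq_eq_sq₀ (norm_nonneg _) (norm_nonneg _), norm_sq_plane, norm_sq_plane]
      simp [squareCross]
    · simp [squareCross, PiLp.inner_apply]
    · have e2 : squareCross r 2 = -squareCross r 1 := by
        refine plane_ext ?_ ?_ <;> simp [squareCross]
      rw [zero_add, zero_add, zero_sub, zero_sub, e2, squareCross_neg,
        Set.pair_comm (-squareCross r 5)]
  · constructor <;> simp [squareCross]
  · constructor <;> simp [squareCross]
  · rw [dist_squareCross h0 h1, dist_squareCross h0 h1]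
    simp [squareCrossDist]
  · rw [dist_squareCross h0 h1]
    simp [squareCrossDist]

theorem IsSquareCross.exists_distEq {μ : ℝ} {x : Fin 6 → Plane}
    (hx : IsSquareCross ![1, 1, 1, 1, μ, μ] x) :
    ∃ r : ℝ, 0 < r ∧ r < 1 ∧ x = squareCross r ∧ distEq r = 0 ∧
      μ = massNum r / massDen r := by
  obtain ⟨r, h0, h1, rfl⟩ := hx.exists_eq_squareCross
  obtain ⟨-, -, l, -, hl⟩ := hx.normalized.cross.1
  rw [centerMass_squareCross] at hl
  exact ⟨r, h0, h1, rfl,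
    (exists_bodyEquations_iff h0 h1).1 ⟨l, (central_equations_iff h0 h1).1 hl⟩⟩

end CrossCC

theorem proposition5p2 :
    ∃ (m₅ : ℝ) (y : Fin 6 → CrossCC.Plane),
      CrossCC.IsSquareCross ![1, 1, 1, 1, m₅, m₅] y ∧
      (∀ (μ : ℝ) (x : Fin 6 → CrossCC.Plane),
        CrossCC.IsSquareCross ![1, 1, 1, 1, μ, μ] x → μ = m₅ ∧ x = y) ∧
      CrossCC.h.natDegree = 52 ∧
      (∀ t : ℝ, t ∈ Set.Ioc (0 : ℝ) 1 →
        (Polynomial.aeval t CrossCC.h = 0 ↔ t = dist (y 0) (y 1))) ∧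
      dist (y 0) (y 1) ∈ Set.Ioc (0.4402418528 : ℝ) 0.4402418529 ∧
      m₅ ∈ Set.Ico (4.76482836 : ℝ) 4.76482837 := by
  obtain ⟨r, hr, hroot⟩ := CrossCC.exists_distEq_eq_zero
  have h0 : 0 < r := by linarith [hr.1]
  have h1 : r < 1 := by linarith [hr.2]
  have hmass := CrossCC.mass_mem_Ico hr
  obtain ⟨l, hl⟩ := (CrossCC.exists_bodyEquations_iff h0 h1).2 ⟨hroot, rfl⟩
  have hh := CrossCC.aeval_h_of_distEq hroot
  have hd : dist (CrossCC.squareCross r 0) (CrossCC.squareCross r 1) = r := by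
    rw [CrossCC.dist_squareCross h0 h1]
    simp [CrossCC.squareCrossDist]
  refine ⟨_, _, CrossCC.isSquareCross_squareCross h0 h1 (by linarith [hmass.1]) hl, ?_,
    CrossCC.natDegree_h, ?_, ?_, hmass⟩
  · intro μ x hx
    obtain ⟨s, hs0, hs1, rfl, hs, rfl⟩ := hx.exists_distEq
    -- A competing configuration also gives a root of `h` in `(0, 1]`, so its parameter agrees; the
    -- mass is a function of the parameter.
    obtain rfl := CrossCC.h_root_unique ⟨hs0, hs1.le⟩ ⟨h0, h1.le⟩
      (CrossCC.aeval_h_of_distEq hs) hh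
    exact ⟨rfl, rfl⟩
  · intro t ht
    rw [hd]
    constructor
    · exact fun h ↦ CrossCC.h_root_unique ht ⟨h0, h1.le⟩ h hh
    · rintro rfl
      exact hh
  · rw [hd]
    exact ⟨by linarith [hr.1], by linarith [hr.2]⟩
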